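/- Let $\Gamma=(V,E,s,r)$ be a directed graph: $V$ and $E$ are arbitrary (possibly infinite or empty) sets of vertices and edges, and $s,r:E\to V$ are the source and range maps. Let $\mathrm{Inv}(\Gamma)$ be the graph inverse semigroup of $\Gamma$, that is, the semigroup with zero generated by $V$, $E$ and $E^*=\{e^*: e\in E\}$ subject to the following relations for all $u,v\in V$ and $e,f\in E$ (with $\delta$ the Kronecker delta): $$uv=\delta_{u,v}u,\qquad s(e)e=e\,r(e)=e,\qquad r(e)e^*=e^*s(e)=e^*,\qquad f^*e=\delta_{f,e}\,r(e).$$ Let $\mathscr{C}(\mathrm{Inv}(\Gamma))$ be the lattice of all congruences on $\mathrm{Inv}(\Gamma)$, ordered by inclusion. If $|s^{-1}(v)|\le 1$ for every vertex $v\in V$, then $\mathscr{C}(\mathrm{Inv}(\Gamma))$ is distributive, that is, $(a\vee b)\wedge c=(a\wedge c)\vee(b\wedge c)$ for all $a,b,c\in\mathscr{C}(\mathrm{Inv}(\Gamma))$. -/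

import Mathlib

universe u v

/-- A directed graph with vertex set `V` and edge set `E`, given by its source and range maps. -/
structure DirectedGraph (V : Type u) (E : Type v) where
  /-- the source of an edge -/
  s : E → V
  /-- the range of an edge -/
  r : E → V

namespace DirectedGraph

variable {V : Type u} {E : Type v}

/-- The index `|s⁻¹(v)|` of a vertex `v`. -/
noncomputable def index (Γ : DirectedGraph V E) (w : V) : Cardinal.{v} :=
  Cardinal.mk (Γ.s ⁻¹' {w} : Set E)

/-- The generators of the graph inverse semigroup: vertices, edges, and the formal inverses
`e*` of edges. -/
inductive Gen (V : Type u) (E : Type v) : Type (max u v)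
  | vertex : V → Gen V E
  | edge : E → Gen V E
  | star : E → Gen V E

/-- The free semigroup with zero on the generators: nonempty words, and an adjoined zero. -/
abbrev FreeZ (V : Type u) (E : Type v) : Type (max u v) :=
  WithZero (FreeSemigroup (Gen V E))

/-- A vertex as an element of the free semigroup with zero. -/
def vtx (E : Type v) (w : V) : FreeZ V E :=
  ((FreeSemigroup.of (Gen.vertex w) : FreeSemigroup (Gen V E)) : FreeZ V E)

/-- An edge as an element of the free semigroup with zero. -/
def edg (V : Type u) (e : E) : FreeZ V E :=
  ((FreeSemigroup.of (Gen.edge e) : FreeSemigroup (Gen V E)) : FreeZ V E)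

/-- The formal inverse of an edge as an element of the free semigroup with zero. -/
def edgStar (V : Type u) (e : E) : FreeZ V E :=
  ((FreeSemigroup.of (Gen.star e) : FreeSemigroup (Gen V E)) : FreeZ V E)

/-- The defining relations (GI1), (GI2), (GI3), (CK1); a relation with a Kronecker delta is split
into its two cases. -/
inductive Rel (Γ : DirectedGraph V E) : FreeZ V E → FreeZ V E → Prop
  | vertex_mul_self (w : V) : Rel Γ (vtx E w * vtx E w) (vtx E w)
  | vertex_mul_of_ne (w x : V) (h : w ≠ x) : Rel Γ (vtx E w * vtx E x) 0
  | source_mul_edge (e : E) : Rel Γ (vtx E (Γ.s e) * edg V e) (edg V e)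
  | edge_mul_range (e : E) : Rel Γ (edg V e * vtx E (Γ.r e)) (edg V e)
  | range_mul_star (e : E) : Rel Γ (vtx E (Γ.r e) * edgStar V e) (edgStar V e)
  | star_mul_source (e : E) : Rel Γ (edgStar V e * vtx E (Γ.s e)) (edgStar V e)
  | star_mul_self (e : E) : Rel Γ (edgStar V e * edg V e) (vtx E (Γ.r e))
  | star_mul_of_ne (f e : E) (h : f ≠ e) : Rel Γ (edgStar V f * edg V e) 0

/-- The graph inverse semigroup `Inv(Γ)`: the semigroup with zero presented by the generators
`V ∪ E ∪ E*` and the relations `Rel Γ`. -/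
def Inv (Γ : DirectedGraph V E) : Type (max u v) :=
  (conGen Γ.Rel).Quotient

instance (Γ : DirectedGraph V E) : SemigroupWithZero Γ.Inv where
  toSemigroup := Con.semigroup (conGen Γ.Rel)
  zero := ((0 : FreeZ V E) : (conGen Γ.Rel).Quotient)
  zero_mul a := Con.induction_on a fun x =>
    congrArg (fun y : FreeZ V E => (y : (conGen Γ.Rel).Quotient)) (zero_mul x)
  mul_zero a := Con.induction_on a fun x =>
    congrArg (fun y : FreeZ V E => (y : (conGen Γ.Rel).Quotient)) (mul_zero x)

/-- The congruence lattice of `Inv(Γ)`: all semigroup congruences, ordered by inclusion. -/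
abbrev CongruenceLattice (Γ : DirectedGraph V E) : Type (max u v) :=
  Con Γ.Inv

end DirectedGraph

/-! When each vertex emits at most one edge, a path is determined by its source and length, and
every element is zero or `x * y'` with `x`, `y` paths ending at the same vertex. Cancelling common
prefixes shows that a congruence is determined by three kinds of pairs (`BasicLE.le`): a vertex `p`
and `0`; `x * x'` and the source of the path `x`; a closed path and its base vertex. So the
nontrivial inclusion need only be checked on these.

Idempotent pairs split into conditions on single edges, and each such condition, if it holds in a
join, already holds in one of the two congruences (`rel_edge_or_of_sup`). If a join kills `p`, one
of its members kills a vertex reachable from `p`, and idempotent pairs carry this back to `p`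
(`rel_zero_sup_inf`). Closed paths are governed by differences of lengths, which form a subgroup of
`ℤ`; there distributivity is that of the subgroups of `ℤ` (`IsPath.rel_closed_sup_inf`). -/

/-- The join of two congruences is the transitive closure of their union. -/
theorem Con.reflTransGen_of_sup {M : Type*} [Mul M] {a b : Con M} {x y : M} (h : (a ⊔ b) x y) :
    Relation.ReflTransGen (fun s t => a s t ∨ b s t) x y := by
  have hsymm : Std.Symm fun s t => a s t ∨ b s t := ⟨fun s t hst => hst.imp a.symm b.symm⟩
  let d : Con M :=
    { r := Relation.ReflTransGen fun s t => a s t ∨ b s t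
      iseqv := ⟨fun _ => .refl, fun h => Relation.ReflTransGen.stdSymm.symm _ _ h,
        fun h₁ h₂ => h₁.trans h₂⟩
      mul' := fun {w x y z} h₁ h₂ =>
        (h₁.lift (· * y) fun s t hst => hst.imp (fun h => a.mul h (a.refl y))
          (fun h => b.mul h (b.refl y))).trans
        (h₂.lift (x * ·) fun s t hst => hst.imp (fun h => a.mul (a.refl x) h)
          (fun h => b.mul (b.refl x) h)) }
  have hd : a ⊔ b ≤ d :=
    sup_le (fun _ _ h => .single (Or.inl h)) (fun _ _ h => .single (Or.inr h))
  exact hd h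

theorem Con.mul_left_rel {M : Type*} [Mul M] (a : Con M) {x y : M} (z : M) (h : a x y) :
    a (z * x) (z * y) := a.mul (a.refl z) h

theorem Con.mul_right_rel {M : Type*} [Mul M] (a : Con M) {x y : M} (z : M) (h : a x y) :
    a (x * z) (y * z) := a.mul h (a.refl z)

theorem mul_mul_eq_of_mul_eq {M : Type*} [Semigroup M] {x y z : M} (h : x * y = z) (t : M) :
    x * (y * t) = z * t := by rw [← mul_assoc, h]

/-- The lattice of subgroups of `ℤ` is distributive. -/
theorem Int.addSubgroup_sup_inf_le (A B C : AddSubgroup ℤ) :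
    (A ⊔ B) ⊓ C ≤ (A ⊓ C) ⊔ (B ⊓ C) := by
  rintro n ⟨hn, hC⟩
  obtain ⟨x, hx, y, hy, rfl⟩ := AddSubgroup.mem_sup.1 hn
  rcases Nat.eq_zero_or_pos (Int.gcd x y) with h0 | h0
  · obtain ⟨rfl, rfl⟩ := Int.gcd_eq_zero_iff.1 h0
    exact zero_mem _
  obtain ⟨x₁, y₁, h1, hx₁, hy₁⟩ := Int.exists_gcd_one h0
  generalize (Int.gcd x y : ℤ) = g at hx₁ hy₁
  have hb := Int.gcd_eq_gcd_ab x₁ y₁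
  rw [h1, Nat.cast_one] at hb
  -- Bézout for the coprime parts: as `x = x₁ g` and `y = y₁ g`, the first summand is also a
  -- multiple of `x` and the second a multiple of `y`.
  have key : x + y = (Int.gcdA x₁ y₁ * x₁) • (x + y) + (Int.gcdB x₁ y₁ * y₁) • (x + y) := by
    rw [smul_eq_mul, smul_eq_mul]
    linear_combination (x + y) * hb
  rw [key]
  refine AddSubgroup.mem_sup.2 ⟨_, ⟨?_, C.zsmul_mem hC _⟩, _, ⟨?_, C.zsmul_mem hC _⟩, rfl⟩
  · have : (Int.gcdA x₁ y₁ * x₁) • (x + y) = (Int.gcdA x₁ y₁ * (x₁ + y₁)) • x := by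
      rw [hx₁, hy₁, smul_eq_mul, smul_eq_mul]; ring
    rw [this]
    exact A.zsmul_mem hx _
  · have : (Int.gcdB x₁ y₁ * y₁) • (x + y) = (Int.gcdB x₁ y₁ * (x₁ + y₁)) • y := by
      rw [hx₁, hy₁, smul_eq_mul, smul_eq_mul]; ring
    rw [this]
    exact B.zsmul_mem hy _

/-! ### Paths in `Inv(Γ)` -/

namespace DirectedGraph

variable {V : Type u} {E : Type v} (Γ : DirectedGraph V E)

/-- The class in `Inv(Γ)` of an element of the free semigroup with zero. -/
def toInv (x : FreeZ V E) : Γ.Inv := (x : (conGen Γ.Rel).Quotient)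

/-- A vertex as an element of the graph inverse semigroup. -/
def vt (w : V) : Γ.Inv := Γ.toInv (vtx E w)

/-- An edge as an element of the graph inverse semigroup. -/
def ed (e : E) : Γ.Inv := Γ.toInv (edg V e)

/-- A formal inverse of an edge as an element of the graph inverse semigroup. -/
def st (e : E) : Γ.Inv := Γ.toInv (edgStar V e)

theorem toInv_eq_of_rel {x y : FreeZ V E} (h : Γ.Rel x y) :
    Γ.toInv x = Γ.toInv y :=
  (Con.eq _).2 (ConGen.Rel.of _ _ h)

theorem vt_mul_self (w : V) : Γ.vt w * Γ.vt w = Γ.vt w := Γ.toInv_eq_of_rel (.vertex_mul_self w)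

theorem vt_mul_of_ne {w x : V} (h : w ≠ x) : Γ.vt w * Γ.vt x = 0 :=
  Γ.toInv_eq_of_rel (.vertex_mul_of_ne w x h)

theorem vt_source_mul_ed (e : E) : Γ.vt (Γ.s e) * Γ.ed e = Γ.ed e :=
  Γ.toInv_eq_of_rel (.source_mul_edge e)

theorem ed_mul_vt_range (e : E) : Γ.ed e * Γ.vt (Γ.r e) = Γ.ed e :=
  Γ.toInv_eq_of_rel (.edge_mul_range e)

theorem vt_range_mul_st (e : E) : Γ.vt (Γ.r e) * Γ.st e = Γ.st e :=
  Γ.toInv_eq_of_rel (.range_mul_star e)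

theorem st_mul_vt_source (e : E) : Γ.st e * Γ.vt (Γ.s e) = Γ.st e :=
  Γ.toInv_eq_of_rel (.star_mul_source e)

theorem st_mul_ed (e : E) : Γ.st e * Γ.ed e = Γ.vt (Γ.r e) :=
  Γ.toInv_eq_of_rel (.star_mul_self e)

theorem st_mul_ed_of_ne {f e : E} (h : f ≠ e) : Γ.st f * Γ.ed e = 0 :=
  Γ.toInv_eq_of_rel (.star_mul_of_ne f e h)

/-- `Γ.IsPath v w n x x'` says that `x` is the element of `Inv(Γ)` given by a path of length `n`
from `v` to `w`, and that `x'` is its inverse. -/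
inductive IsPath : V → V → ℕ → Γ.Inv → Γ.Inv → Prop
  | nil (w : V) : IsPath w w 0 (Γ.vt w) (Γ.vt w)
  | cons (e : E) {w : V} {n : ℕ} {x x' : Γ.Inv} (h : IsPath (Γ.r e) w n x x') :
      IsPath (Γ.s e) w (n + 1) (Γ.ed e * x) (x' * Γ.st e)

variable {Γ}

namespace IsPath

variable {p q w : V} {n m : ℕ} {x x' y y' : Γ.Inv}

theorem vt_mul (h : Γ.IsPath p w n x x') : Γ.vt p * x = x := by
  cases h with
  | nil => exact Γ.vt_mul_self _
  | cons e h => rw [← mul_assoc, vt_source_mul_ed]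

theorem mul_vt' (h : Γ.IsPath p w n x x') : x' * Γ.vt p = x' := by
  cases h with
  | nil => exact Γ.vt_mul_self _
  | cons e h => rw [mul_assoc, st_mul_vt_source]

theorem mul_vt (h : Γ.IsPath p w n x x') : x * Γ.vt w = x := by
  induction h with
  | nil => exact Γ.vt_mul_self _
  | cons e h ih => rw [mul_assoc, ih]

theorem vt_mul' (h : Γ.IsPath p w n x x') : Γ.vt w * x' = x' := by
  induction h with
  | nil => exact Γ.vt_mul_self _
  | cons e h ih => rw [← mul_assoc, ih]

theorem inv_mul (h : Γ.IsPath p w n x x') : x' * x = Γ.vt w := by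
  induction h with
  | nil => exact Γ.vt_mul_self _
  | cons e h ih =>
    rw [mul_assoc, mul_mul_eq_of_mul_eq (st_mul_ed Γ e), h.vt_mul, ih]

theorem edge (e : E) : Γ.IsPath (Γ.s e) (Γ.r e) 1 (Γ.ed e) (Γ.st e) := by
  simpa only [ed_mul_vt_range, vt_range_mul_st] using IsPath.cons e (IsPath.nil (Γ := Γ) (Γ.r e))

theorem append (h : Γ.IsPath p q n x x') (k : Γ.IsPath q w m y y') :
    Γ.IsPath p w (n + m) (x * y) (y' * x') := by
  induction h with
  | nil => rw [k.vt_mul, k.mul_vt', Nat.zero_add]; exact k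
  | cons e h ih =>
    rw [mul_assoc, ← mul_assoc y', Nat.add_right_comm]
    exact IsPath.cons e (ih k)

/-- If every vertex emits at most one edge, two paths with the same source are comparable. -/
theorem exists_of_le (hΓ : Function.Injective Γ.s) (h : Γ.IsPath p q n x x')
    (k : Γ.IsPath p w m y y') (hnm : n ≤ m) :
    ∃ z z', Γ.IsPath q w (m - n) z z' ∧ y = x * z ∧ y' = z' * x' := by
  induction h generalizing m y y' with
  | nil => exact ⟨y, y', k, k.vt_mul.symm, k.mul_vt'.symm⟩
  | @cons e _ n x x' h ih =>
    generalize hs : Γ.s e = p' at k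
    cases k with
    | nil => omega
    | @cons f _ m y y' k =>
      obtain rfl := hΓ hs
      obtain ⟨z, z', hz, rfl, rfl⟩ := ih k (by omega)
      exact ⟨z, z', by simpa using hz, (mul_assoc _ _ _).symm, mul_assoc _ _ _⟩

theorem eq_of_length_eq (hΓ : Function.Injective Γ.s) (h : Γ.IsPath p q n x x')
    (k : Γ.IsPath p w n y y') : q = w ∧ x = y ∧ x' = y' := by
  obtain ⟨z, z', hz, rfl, rfl⟩ := h.exists_of_le hΓ k le_rfl
  rw [Nat.sub_self] at hz
  cases hz
  exact ⟨rfl, h.mul_vt.symm, h.vt_mul'.symm⟩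

end IsPath

/-! ### Normal forms -/

variable (Γ) in
/-- The elements of `Inv(Γ)` that are zero or a path followed by the inverse of a path. -/
def IsNormal (t : Γ.Inv) : Prop :=
  t = 0 ∨ ∃ p q w n m x x' y y', Γ.IsPath p w n x x' ∧ Γ.IsPath q w m y y' ∧ t = x * y'

theorem IsNormal.vt_mul {t : Γ.Inv} (h : Γ.IsNormal t) (u : V) : Γ.IsNormal (Γ.vt u * t) := by
  obtain rfl | ⟨p, q, w, n, m, x, x', y, y', hx, hy, rfl⟩ := h
  · exact Or.inl (mul_zero _)
  rw [← hx.vt_mul, mul_assoc]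
  by_cases hu : u = p
  · subst hu
    rw [mul_mul_eq_of_mul_eq (Γ.vt_mul_self u), ← mul_assoc, hx.vt_mul]
    exact Or.inr ⟨_, _, _, _, _, _, _, _, _, hx, hy, rfl⟩
  · rw [mul_mul_eq_of_mul_eq (Γ.vt_mul_of_ne hu), zero_mul]
    exact Or.inl rfl

theorem IsNormal.ed_mul {t : Γ.Inv} (h : Γ.IsNormal t) (e : E) : Γ.IsNormal (Γ.ed e * t) := by
  obtain rfl | ⟨p, q, w, n, m, x, x', y, y', hx, hy, rfl⟩ := h
  · exact Or.inl (mul_zero _)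
  by_cases hu : Γ.r e = p
  · subst hu
    exact Or.inr ⟨_, _, _, _, _, _, _, _, _, .cons e hx, hy, (mul_assoc _ _ _).symm⟩
  · rw [← hx.vt_mul, ← Γ.ed_mul_vt_range, mul_assoc, mul_assoc,
      mul_mul_eq_of_mul_eq (Γ.vt_mul_of_ne hu), zero_mul, mul_zero]
    exact Or.inl rfl

theorem IsNormal.st_mul {t : Γ.Inv} (h : Γ.IsNormal t) (e : E) : Γ.IsNormal (Γ.st e * t) := by
  obtain rfl | ⟨p, q, w, n, m, x, x', y, y', hx, hy, rfl⟩ := h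
  · exact Or.inl (mul_zero _)
  by_cases hu : Γ.s e = p
  · cases hx with
    | nil =>
      subst hu
      have hye := hy.append (.edge e)
      refine Or.inr ⟨_, _, _, _, _, _, _, _, _, .nil (Γ.r e), hye, ?_⟩
      rw [hy.vt_mul', mul_mul_eq_of_mul_eq (Γ.vt_range_mul_st e)]
    | @cons f _ n x x' hx =>
      rw [mul_assoc]
      by_cases hf : e = f
      · subst hf
        rw [mul_mul_eq_of_mul_eq (Γ.st_mul_ed e), mul_mul_eq_of_mul_eq hx.vt_mul]
        exact Or.inr ⟨_, _, _, _, _, _, _, _, _, hx, hy, rfl⟩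
      · rw [mul_mul_eq_of_mul_eq (Γ.st_mul_ed_of_ne hf), zero_mul]
        exact Or.inl rfl
  · rw [← hx.vt_mul, ← Γ.st_mul_vt_source, mul_assoc, mul_assoc,
      mul_mul_eq_of_mul_eq (Γ.vt_mul_of_ne hu), zero_mul, mul_zero]
    exact Or.inl rfl

theorem IsNormal.of_vt (w : V) : Γ.IsNormal (Γ.vt w) :=
  Or.inr ⟨_, _, _, _, _, _, _, _, _, .nil w, .nil w, (Γ.vt_mul_self w).symm⟩

variable (Γ) in
/-- Every element of `Inv(Γ)` is zero or a path followed by the inverse of a path. -/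
theorem isNormal (t : Γ.Inv) : Γ.IsNormal t := by
  have hgen (g : Gen V E) (t : Γ.Inv) (ht : Γ.IsNormal t) : Γ.IsNormal
      (Γ.toInv (FreeSemigroup.of g : FreeSemigroup (Gen V E)) * t) := by
    cases g with
    | vertex w => exact ht.vt_mul w
    | edge e => exact ht.ed_mul e
    | star e => exact ht.st_mul e
  induction t using Con.induction_on with
  | H t =>
  induction t using WithZero.recZeroCoe with
  | zero => exact Or.inl rfl
  | coe t =>
    induction t using FreeSemigroup.recOnMul with
    | ih1 g =>
      cases g with
      | vertex w => exact .of_vt w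
      | edge e =>
        have := (IsNormal.of_vt (Γ := Γ) (Γ.r e)).ed_mul e
        rwa [ed_mul_vt_range] at this
      | star e =>
        have := (IsNormal.of_vt (Γ := Γ) (Γ.s e)).st_mul e
        rwa [st_mul_vt_source] at this
    | ih2 g t hg ht => exact hgen g _ ht

/-! ### Killed vertices and edge idempotents -/

namespace IsPath

variable {p q w : V} {n m : ℕ} {x x' y y' : Γ.Inv}

theorem eq_nil_or_cons (h : Γ.IsPath p w n x x') :
    (p = w ∧ n = 0 ∧ x = Γ.vt p ∧ x' = Γ.vt p) ∨ ∃ e k z z', p = Γ.s e ∧ n = k + 1 ∧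
      Γ.IsPath (Γ.r e) w k z z' ∧ x = Γ.ed e * z ∧ x' = z' * Γ.st e := by
  cases h with
  | nil => exact Or.inl ⟨rfl, rfl, rfl, rfl⟩
  | cons e h => exact Or.inr ⟨e, _, _, _, rfl, rfl, h, rfl, rfl⟩

theorem vt_mul_of_ne {u : V} (h : Γ.IsPath p w n x x') (hu : u ≠ p) : Γ.vt u * x = 0 := by
  rw [← h.vt_mul, ← mul_assoc, Γ.vt_mul_of_ne hu, zero_mul]

theorem mul_vt_of_ne' {u : V} (h : Γ.IsPath p w n x x') (hu : u ≠ p) : x' * Γ.vt u = 0 := by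
  rw [← h.mul_vt', mul_assoc, Γ.vt_mul_of_ne hu.symm, mul_zero]

/-- Since `x' * x` and `y' * y` both equal the vertex `w`, multiplying by `x'` and `y` undoes
multiplying by `x` and `y'`. -/
theorem rel_zero_iff (hx : Γ.IsPath p w n x x') (hy : Γ.IsPath q w m y y') (a : Con Γ.Inv) :
    a (x * y') 0 ↔ a (Γ.vt w) 0 := by
  constructor <;> intro h
  · have := a.mul_right_rel y (a.mul_left_rel x' h)
    rwa [mul_zero, zero_mul, ← mul_assoc, hx.inv_mul, hy.vt_mul', hy.inv_mul] at this
  · have := a.mul_right_rel y' (a.mul_left_rel x h)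
    rwa [mul_zero, zero_mul, hx.mul_vt] at this

theorem rel_idem_cons_iff (a : Con Γ.Inv) (e : E) (hx : Γ.IsPath (Γ.r e) w n x x') :
    a (Γ.ed e * x * (x' * Γ.st e)) (Γ.vt (Γ.s e)) ↔
      a (Γ.ed e * Γ.st e) (Γ.vt (Γ.s e)) ∧ a (x * x') (Γ.vt (Γ.r e)) := by
  constructor
  · intro h
    constructor
    · have := a.mul_left_rel (Γ.ed e * Γ.st e) h
      simp only [mul_assoc, mul_mul_eq_of_mul_eq (Γ.st_mul_ed e), mul_mul_eq_of_mul_eq hx.vt_mul,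
        st_mul_vt_source] at this h
      exact a.trans (a.symm this) h
    · have := a.mul_right_rel (Γ.ed e) (a.mul_left_rel (Γ.st e) h)
      simpa only [mul_assoc, mul_mul_eq_of_mul_eq (Γ.st_mul_ed e), mul_mul_eq_of_mul_eq hx.vt_mul,
        st_mul_ed, hx.mul_vt', vt_source_mul_ed] using this
  · rintro ⟨h₁, h₂⟩
    have := a.mul_right_rel (Γ.st e) (a.mul_left_rel (Γ.ed e) h₂)
    rw [ed_mul_vt_range] at this
    simp only [mul_assoc] at this ⊢
    exact a.trans this h₁

end IsPath

/-- Either `a` kills the vertex, or `t` begins with `e` or ends with its inverse, because `e` is the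
only edge leaving there. Then `e e*` fixes `t` on that side, and multiplying `h` by it gives the
claim. -/
theorem rel_edge_of_rel_of_ne (hΓ : Function.Injective Γ.s) {a : Con Γ.Inv} {e : E} {t : Γ.Inv}
    (h : a (Γ.vt (Γ.s e)) t) (ht : t ≠ Γ.vt (Γ.s e)) :
    a (Γ.ed e * Γ.st e) (Γ.vt (Γ.s e)) := by
  have hz (h0 : a (Γ.vt (Γ.s e)) 0) : a (Γ.ed e * Γ.st e) (Γ.vt (Γ.s e)) := by
    have := a.mul_left_rel (Γ.ed e * Γ.st e) h0
    rw [mul_assoc, st_mul_vt_source, mul_zero] at this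
    exact a.trans this (a.symm h0)
  obtain rfl | ⟨p, q, w, n, m, x, x', y, y', hx, hy, rfl⟩ := Γ.isNormal t
  · exact hz h
  by_cases hp : Γ.s e = p
  swap
  · have := a.mul_left_rel (Γ.vt (Γ.s e)) h
    rw [vt_mul_self, ← mul_assoc, hx.vt_mul_of_ne hp, zero_mul] at this
    exact hz this
  by_cases hq : Γ.s e = q
  swap
  · have := a.mul_right_rel (Γ.vt (Γ.s e)) h
    rw [vt_mul_self, mul_assoc, hy.mul_vt_of_ne' hq, mul_zero] at this
    exact hz this
  obtain ⟨rfl, -, rfl, -⟩ | ⟨f, k, z, z', hf, -, hz, rfl, rfl⟩ := hx.eq_nil_or_cons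
  · obtain ⟨rfl, -, rfl, rfl⟩ | ⟨f, k, z, z', hf, -, hz, rfl, rfl⟩ := hy.eq_nil_or_cons
    · rw [vt_mul_self, ← hp] at ht
      exact absurd rfl ht
    · obtain rfl := hΓ (hq.trans hf)
      have := a.mul_right_rel (Γ.ed e * Γ.st e) h
      simp only [mul_assoc, mul_mul_eq_of_mul_eq (Γ.st_mul_ed e), vt_range_mul_st,
        mul_mul_eq_of_mul_eq (Γ.vt_source_mul_ed e)] at this
      exact a.trans this (a.symm h)
  · obtain rfl := hΓ (hp.trans hf)
    have := a.mul_left_rel (Γ.ed e * Γ.st e) h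
    simp only [mul_assoc, mul_mul_eq_of_mul_eq (Γ.st_mul_ed e), mul_mul_eq_of_mul_eq hz.vt_mul,
      st_mul_vt_source] at this
    simp only [mul_assoc] at h
    exact a.trans this (a.symm h)

/-- If neither congruence identifies the pair, the class of the vertex is a singleton in both, so no
chain can leave it. -/
theorem rel_edge_or_of_sup (hΓ : Function.Injective Γ.s) {a b : Con Γ.Inv} {e : E}
    (h : (a ⊔ b) (Γ.ed e * Γ.st e) (Γ.vt (Γ.s e))) :
    a (Γ.ed e * Γ.st e) (Γ.vt (Γ.s e)) ∨ b (Γ.ed e * Γ.st e) (Γ.vt (Γ.s e)) := by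
  by_contra! hab
  have key : ∀ t, Relation.ReflTransGen (fun s t => a s t ∨ b s t) (Γ.vt (Γ.s e)) t →
      t = Γ.vt (Γ.s e) := by
    intro t ht
    induction ht with
    | refl => rfl
    | tail _ h ih =>
      subst ih
      by_contra hne
      rcases h with h | h
      · exact hab.1 (rel_edge_of_rel_of_ne hΓ h hne)
      · exact hab.2 (rel_edge_of_rel_of_ne hΓ h hne)
  have := key _ (Con.reflTransGen_of_sup ((a ⊔ b).symm h))
  exact hab.1 (this ▸ a.refl _)

theorem IsPath.rel_idem_sup_inf (hΓ : Function.Injective Γ.s) {a b c : Con Γ.Inv} {p w : V}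
    {n : ℕ} {x x' : Γ.Inv} (hx : Γ.IsPath p w n x x') (h : (a ⊔ b) (x * x') (Γ.vt p))
    (hc : c (x * x') (Γ.vt p)) : ((a ⊓ c) ⊔ (b ⊓ c)) (x * x') (Γ.vt p) := by
  induction hx with
  | nil w => rw [vt_mul_self]; exact Con.refl _ _
  | cons e hx ih =>
    rw [rel_idem_cons_iff _ e hx] at h hc ⊢
    refine ⟨?_, ih h.2 hc.2⟩
    rcases rel_edge_or_of_sup hΓ h.1 with h | h
    · exact (le_sup_left : a ⊓ c ≤ a ⊓ c ⊔ b ⊓ c) (Con.inf_iff_and.2 ⟨h, hc.1⟩)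
    · exact (le_sup_right : b ⊓ c ≤ a ⊓ c ⊔ b ⊓ c) (Con.inf_iff_and.2 ⟨h, hc.1⟩)

/-- If no vertex reachable from `p` is killed by `a` or `b`, a chain starting at `p` stays among the
elements `x * y'` with `x` starting at `p`, and so cannot reach zero. -/
theorem exists_isPath_rel_zero_of_sup {a b : Con Γ.Inv} {p : V} (h : (a ⊔ b) (Γ.vt p) 0) :
    ∃ w n x x', Γ.IsPath p w n x x' ∧ (a (Γ.vt w) 0 ∨ b (Γ.vt w) 0) := by
  by_contra! hno
  have step (d : Con Γ.Inv) (hd : ∀ w n x x', Γ.IsPath p w n x x' → ¬ d (Γ.vt w) 0)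
      {s t : Γ.Inv} (hst : d s t)
      (hs : ∃ q w n m x x' y y', Γ.IsPath p w n x x' ∧ Γ.IsPath q w m y y' ∧ s = x * y') :
      ∃ q w n m x x' y y', Γ.IsPath p w n x x' ∧ Γ.IsPath q w m y y' ∧ t = x * y' := by
    obtain ⟨q, w, n, m, x, x', y, y', hx, hy, rfl⟩ := hs
    have hs0 : ¬ d (x * y') 0 := by
      rw [hx.rel_zero_iff hy]
      exact hd _ _ _ _ hx
    obtain rfl | ⟨p₁, q₁, w₁, n₁, m₁, x₁, x₁', y₁, y₁', hx₁, hy₁, rfl⟩ := Γ.isNormal t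
    · exact absurd hst hs0
    by_cases hp : p = p₁
    · subst hp
      exact ⟨_, _, _, _, _, _, _, _, hx₁, hy₁, rfl⟩
    · have := d.mul_left_rel (Γ.vt p) hst
      rw [← mul_assoc, hx.vt_mul, ← mul_assoc, hx₁.vt_mul_of_ne hp, zero_mul] at this
      exact absurd this hs0
  have key : ∀ t, Relation.ReflTransGen (fun s t => a s t ∨ b s t) (Γ.vt p) t →
      ∃ q w n m x x' y y', Γ.IsPath p w n x x' ∧ Γ.IsPath q w m y y' ∧ t = x * y' := by
    intro t ht
    induction ht with
    | refl => exact ⟨_, _, _, _, _, _, _, _, .nil p, .nil p, (Γ.vt_mul_self p).symm⟩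
    | tail _ h ih =>
      rcases h with h | h
      · exact step a (fun w n x x' hx => (hno w n x x' hx).1) h ih
      · exact step b (fun w n x x' hx => (hno w n x x' hx).2) h ih
  obtain ⟨q, w, n, m, x, x', y, y', hx, hy, h0⟩ := key _ (Con.reflTransGen_of_sup h)
  exact (hno _ _ _ _ hx).1 ((hx.rel_zero_iff hy a).1 (h0 ▸ a.refl _))

theorem rel_zero_sup_inf (hΓ : Function.Injective Γ.s) {a b c : Con Γ.Inv} {p : V}
    (h : (a ⊔ b) (Γ.vt p) 0) (hc : c (Γ.vt p) 0) : ((a ⊓ c) ⊔ (b ⊓ c)) (Γ.vt p) 0 := by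
  obtain ⟨w, n, x, x', hx, hw⟩ := exists_isPath_rel_zero_of_sup h
  have idem (d : Con Γ.Inv) (hd : d (Γ.vt p) 0) : d (x * x') (Γ.vt p) := by
    have := d.mul_right_rel (x * x') hd
    rw [← mul_assoc, hx.vt_mul, zero_mul] at this
    exact d.trans this (d.symm hd)
  have hcw : c (Γ.vt w) 0 := by
    have := c.mul_right_rel x (c.mul_left_rel x' hc)
    rwa [hx.mul_vt', hx.inv_mul, mul_zero, zero_mul] at this
  have hdw : ((a ⊓ c) ⊔ (b ⊓ c)) (Γ.vt w) 0 := by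
    rcases hw with h | h
    · exact (le_sup_left : a ⊓ c ≤ a ⊓ c ⊔ b ⊓ c) (Con.inf_iff_and.2 ⟨h, hcw⟩)
    · exact (le_sup_right : b ⊓ c ≤ a ⊓ c ⊔ b ⊓ c) (Con.inf_iff_and.2 ⟨h, hcw⟩)
  exact Con.trans _ (Con.symm _ (hx.rel_idem_sup_inf hΓ (idem _ h) (idem _ hc)))
    ((hx.rel_zero_iff hx _).2 hdw)

/-! ### Degrees of closed paths -/

/-- The differences of the lengths of closed paths at `p` that are identified by `a`. -/
def degreeSubgroup (a : Con Γ.Inv) (p : V) : AddSubgroup ℤ where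
  carrier := {i | ∃ (n m : ℕ) (x x' y y' : Γ.Inv), Γ.IsPath p p n x x' ∧ Γ.IsPath p p m y y' ∧
    a x y ∧ i = n - m}
  zero_mem' := ⟨0, 0, _, _, _, _, .nil p, .nil p, a.refl _, by simp⟩
  add_mem' := by
    rintro _ _ ⟨n, m, x, x', y, y', hx, hy, h, rfl⟩ ⟨n₁, m₁, x₁, x₁', y₁, y₁', hx₁, hy₁, h₁, rfl⟩
    exact ⟨_, _, _, _, _, _, hx.append hx₁, hy.append hy₁, a.mul h h₁, by push_cast; ring⟩
  neg_mem' := by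
    rintro _ ⟨n, m, x, x', y, y', hx, hy, h, rfl⟩
    exact ⟨_, _, _, _, _, _, hy, hx, a.symm h, by ring⟩

theorem natCast_mem_degreeSubgroup (hΓ : Function.Injective Γ.s) {a : Con Γ.Inv} {p : V} {n : ℕ} :
    (n : ℤ) ∈ degreeSubgroup a p ↔ ∃ x x', Γ.IsPath p p n x x' ∧ a x (Γ.vt p) := by
  constructor
  · rintro ⟨k, m, x, x', y, y', hx, hy, h, hn⟩
    obtain rfl : k = m + n := by omega
    obtain ⟨z, z', hz, rfl, rfl⟩ := hy.exists_of_le hΓ hx (by omega)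
    have := a.mul_left_rel y' h
    rw [← mul_assoc, hy.inv_mul, hz.vt_mul] at this
    exact ⟨z, z', by simpa using hz, this⟩
  · rintro ⟨x, x', hx, h⟩
    exact ⟨_, _, _, _, _, _, hx, .nil p, h, by simp⟩

theorem degreeSubgroup_inf_le (hΓ : Function.Injective Γ.s) (a b : Con Γ.Inv) (p : V) :
    degreeSubgroup a p ⊓ degreeSubgroup b p ≤ degreeSubgroup (a ⊓ b) p := by
  have key (n : ℕ) (ha : (n : ℤ) ∈ degreeSubgroup a p) (hb : (n : ℤ) ∈ degreeSubgroup b p) :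
      (n : ℤ) ∈ degreeSubgroup (a ⊓ b) p := by
    rw [natCast_mem_degreeSubgroup hΓ] at *
    obtain ⟨x, x', hx, ha⟩ := ha
    obtain ⟨y, y', hy, hb⟩ := hb
    obtain ⟨-, rfl, rfl⟩ := hx.eq_of_length_eq hΓ hy
    exact ⟨_, _, hx, Con.inf_iff_and.2 ⟨ha, hb⟩⟩
  rintro i ⟨ha, hb⟩
  obtain ⟨n, rfl | rfl⟩ := Int.eq_nat_or_neg i
  · exact key n ha hb
  · exact neg_mem (key n (neg_mem_iff.1 ha) (neg_mem_iff.1 hb))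

theorem degreeSubgroup_mono {a b : Con Γ.Inv} (h : a ≤ b) (p : V) :
    degreeSubgroup a p ≤ degreeSubgroup b p := by
  rintro _ ⟨n, m, x, x', y, y', hx, hy, hxy, rfl⟩
  exact ⟨_, _, _, _, _, _, hx, hy, h hxy, rfl⟩

theorem IsPath.exists_closed_ge {p : V} {n : ℕ} {x x' : Γ.Inv} (hx : Γ.IsPath p p n x x')
    (hn : 0 < n) (N : ℕ) : ∃ M z z', N ≤ M ∧ Γ.IsPath p p M z z' := by
  induction N with
  | zero => exact ⟨_, _, _, Nat.zero_le _, .nil p⟩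
  | succ N ih =>
    obtain ⟨M, z, z', hM, hz⟩ := ih
    exact ⟨_, _, _, by omega, hz.append hx⟩

/-- Multiplying `x * y'` by suitable closed paths gives a closed path. -/
theorem IsPath.exists_closed_eq (hΓ : Function.Injective Γ.s) {p w : V} {n m N M : ℕ}
    {x x' y y' z z' t t' : Γ.Inv} (hx : Γ.IsPath p w n x x') (hy : Γ.IsPath p w m y y')
    (hz : Γ.IsPath p p N z z') (ht : Γ.IsPath p p M t t') (hN : n ≤ N) (hM : N + m ≤ M) :
    ∃ k u', Γ.IsPath p p k (z' * (x * y') * t) u' ∧ (k : ℤ) = M - N + (n - m) := by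
  obtain ⟨z₁, z₁', hz₁, rfl, rfl⟩ := hx.exists_of_le hΓ hz hN
  obtain ⟨t₁, t₁', ht₁, rfl, rfl⟩ := hy.exists_of_le hΓ ht (by omega)
  obtain ⟨u, u', hu, rfl, rfl⟩ := hz₁.exists_of_le hΓ ht₁ (by omega)
  -- Here `z = x * z₁` and `t = y * z₁ * u`, so everything cancels except `u`.
  refine ⟨M - m - (N - n), u', ?_, ?_⟩
  · have : z₁' * x' * (x * y') * (y * (z₁ * u)) = u := by
      simp only [mul_assoc, mul_mul_eq_of_mul_eq hx.inv_mul, mul_mul_eq_of_mul_eq hy.inv_mul,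
        mul_mul_eq_of_mul_eq hz₁.vt_mul, mul_mul_eq_of_mul_eq hz₁.inv_mul, hu.vt_mul]
    rw [this]
    exact hu
  · omega

section Closed

variable {p w w₁ : V} {l n m n₁ m₁ : ℕ} {c c' x x' y y' x₁ x₁' y₁ y₁' : Γ.Inv} {a : Con Γ.Inv}

/-- Multiplying both sides by the same long closed paths turns them into closed paths whose lengths
differ by the stated amount; `c` supplies arbitrarily long ones. -/
theorem sub_mem_degreeSubgroup (hΓ : Function.Injective Γ.s) (hc : Γ.IsPath p p l c c')
    (hl : 0 < l) (hx : Γ.IsPath p w n x x') (hy : Γ.IsPath p w m y y')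
    (hx₁ : Γ.IsPath p w₁ n₁ x₁ x₁') (hy₁ : Γ.IsPath p w₁ m₁ y₁ y₁')
    (h : a (x * y') (x₁ * y₁')) : ((n : ℤ) - m) - (n₁ - m₁) ∈ degreeSubgroup a p := by
  obtain ⟨N, z, z', hN, hz⟩ := hc.exists_closed_ge hl (n + n₁)
  obtain ⟨M, t, t', hM, ht⟩ := hc.exists_closed_ge hl (N + m + m₁)
  obtain ⟨k, u, hu, hk⟩ := hx.exists_closed_eq hΓ hy hz ht (by omega) (by omega)
  obtain ⟨k₁, u₁, hu₁, hk₁⟩ := hx₁.exists_closed_eq hΓ hy₁ hz ht (by omega) (by omega)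
  exact ⟨_, _, _, _, _, _, hu, hu₁, a.mul_right_rel t (a.mul_left_rel z' h), by omega⟩

/-- Some closed path through `w` is killed, and so is its product with `c`; these two related closed
paths differ in length by `l`. -/
theorem mem_degreeSubgroup_of_rel_zero (hΓ : Function.Injective Γ.s) (hc : Γ.IsPath p p l c c')
    (hl : 0 < l) (hx : Γ.IsPath p w n x x') (hy : Γ.IsPath p w m y y')
    (h : a (x * y') 0) : (l : ℤ) ∈ degreeSubgroup a p := by
  rw [hx.rel_zero_iff hy] at h
  obtain ⟨N, z, z', hN, hz⟩ := hc.exists_closed_ge hl n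
  obtain ⟨t, t', ht, rfl, rfl⟩ := hx.exists_of_le hΓ hz hN
  have h0 := a.mul_right_rel t (a.mul_left_rel x h)
  rw [hx.mul_vt, mul_zero, zero_mul] at h0
  have h1 := a.mul_right_rel c h0
  rw [zero_mul] at h1
  exact ⟨_, _, _, _, _, _, hz.append hc, hz, a.trans h1 (a.symm h0), by push_cast; ring⟩

end Closed

/-- Along a chain from `p` to `c`, the degree `n - m` of a normal form stays in the sum of the two
subgroups. A chain meeting zero would already put `l` there. -/
theorem IsPath.mem_sup_degreeSubgroup (hΓ : Function.Injective Γ.s) {a b : Con Γ.Inv} {p : V}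
    {l : ℕ} {c c' : Γ.Inv} (hc : Γ.IsPath p p l c c') (hl : 0 < l)
    (h : (a ⊔ b) c (Γ.vt p)) : (l : ℤ) ∈ degreeSubgroup a p ⊔ degreeSubgroup b p := by
  by_contra hno
  have step (d : Con Γ.Inv) (hd : degreeSubgroup d p ≤ degreeSubgroup a p ⊔ degreeSubgroup b p)
      {s t : Γ.Inv} (hst : d s t)
      (hs : ∃ (w : V) (n m : ℕ) (x x' y y' : Γ.Inv), Γ.IsPath p w n x x' ∧ Γ.IsPath p w m y y' ∧
        s = x * y' ∧ (n : ℤ) - m ∈ degreeSubgroup a p ⊔ degreeSubgroup b p) :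
      ∃ (w : V) (n m : ℕ) (x x' y y' : Γ.Inv), Γ.IsPath p w n x x' ∧ Γ.IsPath p w m y y' ∧
        t = x * y' ∧ (n : ℤ) - m ∈ degreeSubgroup a p ⊔ degreeSubgroup b p := by
    obtain ⟨w, n, m, x, x', y, y', hx, hy, rfl, hmem⟩ := hs
    have hs0 : ¬ d (x * y') 0 := fun h0 =>
      hno (hd (mem_degreeSubgroup_of_rel_zero hΓ hc hl hx hy h0))
    obtain rfl | ⟨p₁, q₁, w₁, n₁, m₁, x₁, x₁', y₁, y₁', hx₁, hy₁, rfl⟩ := Γ.isNormal t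
    · exact absurd hst hs0
    by_cases hp : p = p₁
    swap
    · have := d.mul_left_rel (Γ.vt p) hst
      rw [← mul_assoc, hx.vt_mul, ← mul_assoc, hx₁.vt_mul_of_ne hp, zero_mul] at this
      exact absurd this hs0
    by_cases hq : p = q₁
    swap
    · have := d.mul_right_rel (Γ.vt p) hst
      rw [mul_assoc, hy.mul_vt', mul_assoc, hy₁.mul_vt_of_ne' hq, mul_zero] at this
      exact absurd this hs0
    subst hp hq
    refine ⟨_, _, _, _, _, _, _, hx₁, hy₁, rfl, ?_⟩
    have := sub_mem hmem (hd (sub_mem_degreeSubgroup hΓ hc hl hx hy hx₁ hy₁ hst))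
    rwa [sub_sub_cancel] at this
  have key : ∀ t, Relation.ReflTransGen (fun s t => a s t ∨ b s t) (Γ.vt p) t →
      ∃ (w : V) (n m : ℕ) (x x' y y' : Γ.Inv), Γ.IsPath p w n x x' ∧ Γ.IsPath p w m y y' ∧
        t = x * y' ∧ (n : ℤ) - m ∈ degreeSubgroup a p ⊔ degreeSubgroup b p := by
    intro t ht
    induction ht with
    | refl => exact ⟨_, _, _, _, _, _, _, .nil p, .nil p, (Γ.vt_mul_self p).symm, by simp⟩
    | tail _ h ih =>
      rcases h with h | h
      · exact step a le_sup_left h ih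
      · exact step b le_sup_right h ih
  obtain ⟨w, n, m, x, x', y, y', hx, hy, heq, hmem⟩ :=
    key _ (Con.reflTransGen_of_sup ((a ⊔ b).symm h))
  -- The two normal forms are equal as elements; treating the equality as an `a`-relation compares
  -- their degrees without uniqueness of normal forms.
  have hrel : a (x * y') (c * Γ.vt p) := by
    rw [hc.mul_vt, ← heq]
    exact a.refl _
  have := sub_mem hmem ((le_sup_left : _ ≤ degreeSubgroup a p ⊔ degreeSubgroup b p)
    (sub_mem_degreeSubgroup hΓ hc hl hx hy hc (.nil p) hrel))
  rw [sub_sub_cancel, Nat.cast_zero, sub_zero] at this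
  exact hno this

theorem IsPath.rel_closed_sup_inf (hΓ : Function.Injective Γ.s) {a b c : Con Γ.Inv} {p : V}
    {n : ℕ} {x x' : Γ.Inv} (hx : Γ.IsPath p p n x x') (h : (a ⊔ b) x (Γ.vt p))
    (hc : c x (Γ.vt p)) : ((a ⊓ c) ⊔ (b ⊓ c)) x (Γ.vt p) := by
  rcases Nat.eq_zero_or_pos n with rfl | hn
  · rw [(hx.eq_of_length_eq hΓ (.nil p)).2.1]
    exact Con.refl _ _
  have hmem : (n : ℤ) ∈ degreeSubgroup (a ⊓ c ⊔ b ⊓ c) p := by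
    have hcn := (natCast_mem_degreeSubgroup hΓ).2 ⟨x, x', hx, hc⟩
    have := Int.addSubgroup_sup_inf_le _ _ _ ⟨hx.mem_sup_degreeSubgroup hΓ hn h, hcn⟩
    have hle : degreeSubgroup a p ⊓ degreeSubgroup c p ⊔ degreeSubgroup b p ⊓ degreeSubgroup c p ≤
        degreeSubgroup (a ⊓ c ⊔ b ⊓ c) p :=
      sup_le ((degreeSubgroup_inf_le hΓ a c p).trans (degreeSubgroup_mono le_sup_left p))
        ((degreeSubgroup_inf_le hΓ b c p).trans (degreeSubgroup_mono le_sup_right p))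
    exact hle this
  obtain ⟨y, y', hy, hd⟩ := (natCast_mem_degreeSubgroup hΓ).1 hmem
  rwa [(hx.eq_of_length_eq hΓ hy).2.1]

/-! ### Testing inclusion of congruences -/

/-- The pairs on which the inclusion of one congruence in another can be tested. -/
structure BasicLE (a d : Con Γ.Inv) : Prop where
  zero : ∀ p, a (Γ.vt p) 0 → d (Γ.vt p) 0
  idem : ∀ p w n x x', Γ.IsPath p w n x x' → a (x * x') (Γ.vt p) → d (x * x') (Γ.vt p)
  closed : ∀ p n x x', Γ.IsPath p p n x x' → a x (Γ.vt p) → d x (Γ.vt p)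

namespace BasicLE

variable {a d : Con Γ.Inv} {p q w w₁ w₂ : V} {n m n₁ m₁ : ℕ}
  {x x' y y' x₁ x₁' y₁ y₁' : Γ.Inv}

/-- Writing `x = y * l` with `l` closed, the relation splits into `l ~ w` and `y * y' ~ p`, both
basic. -/
theorem rel_mul_inv_of_le (H : BasicLE a d) (hΓ : Function.Injective Γ.s)
    (hx : Γ.IsPath p w n x x') (hy : Γ.IsPath p w m y y') (hmn : m ≤ n)
    (h : a (x * y') (Γ.vt p)) : d (x * y') (Γ.vt p) := by
  obtain ⟨l, l', hl, rfl, rfl⟩ := hy.exists_of_le hΓ hx hmn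
  have hal : a l (Γ.vt w) := by
    have := a.mul_right_rel y (a.mul_left_rel y' h)
    simpa only [mul_assoc, hy.inv_mul, mul_mul_eq_of_mul_eq hy.inv_mul, hl.mul_vt, hl.vt_mul,
      hy.vt_mul] using this
  have hay : a (y * y') (Γ.vt p) := by
    have := a.mul_left_rel (y * y') h
    simp only [mul_assoc, hy.mul_vt', mul_mul_eq_of_mul_eq hy.inv_mul,
      mul_mul_eq_of_mul_eq hl.vt_mul] at this h
    exact a.trans (a.symm this) h
  have := d.mul_right_rel y' (d.mul_left_rel y (H.closed _ _ _ _ hl hal))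
  rw [hy.mul_vt] at this
  exact d.trans this (H.idem _ _ _ _ _ hy hay)

theorem rel_mul_inv (H : BasicLE a d) (hΓ : Function.Injective Γ.s)
    (hx : Γ.IsPath p w n x x') (hy : Γ.IsPath p w m y y')
    (h : a (x * y') (Γ.vt p)) : d (x * y') (Γ.vt p) := by
  rcases le_total m n with hmn | hmn
  · exact H.rel_mul_inv_of_le hΓ hx hy hmn h
  have hax : a (x * x') (Γ.vt p) := by
    have := a.mul_left_rel (x * x') h
    simp only [mul_assoc, hx.mul_vt', mul_mul_eq_of_mul_eq hx.inv_mul, hy.vt_mul'] at this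
    exact a.trans (a.symm this) h
  obtain ⟨l, l', hl, rfl, rfl⟩ := hx.exists_of_le hΓ hy hmn
  have hal : a l (Γ.vt w) := by
    have h1 := a.mul_right_rel x (a.mul_left_rel x' h)
    simp only [mul_assoc, hx.inv_mul, mul_mul_eq_of_mul_eq hx.inv_mul, hl.mul_vt', hl.vt_mul',
      hx.vt_mul] at h1
    have h2 := a.mul_right_rel l h1
    rw [hl.inv_mul, hl.vt_mul] at h2
    exact a.symm h2
  have hdl : d l' (Γ.vt w) := by
    have := d.mul_left_rel l' (H.closed _ _ _ _ hl hal)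
    rw [hl.inv_mul, hl.mul_vt'] at this
    exact d.symm this
  have := d.mul_right_rel x' (d.mul_left_rel x hdl)
  rw [hx.mul_vt, mul_assoc] at this
  exact d.trans this (H.idem _ _ _ _ _ hx hax)

/-- The basic pairs `x * y ~ p` and `y * y' ~ w` give `y' ~ x * y * y' ~ x`. -/
theorem rel_inv (H : BasicLE a d) (hx : Γ.IsPath p w n x x') (hy : Γ.IsPath w p m y y')
    (h : a y' x) : d y' x := by
  have hxy : a (x * y) (Γ.vt p) := by
    have := a.mul_right_rel y h
    rw [hy.inv_mul] at this
    exact a.symm this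
  have hyy : a (y * y') (Γ.vt w) := by
    have h1 := a.mul_left_rel x' h
    rw [hx.inv_mul] at h1
    have h2 := a.mul_right_rel (y * y') h1
    simp only [mul_assoc, mul_mul_eq_of_mul_eq hy.inv_mul, hy.vt_mul',
      mul_mul_eq_of_mul_eq hy.vt_mul] at h2
    exact a.trans (a.symm h2) h1
  have h1 := d.mul_right_rel y' (H.closed _ _ _ _ (hx.append hy) hxy)
  have h2 := d.mul_left_rel x (H.idem _ _ _ _ _ hy hyy)
  rw [hy.vt_mul', mul_assoc] at h1
  rw [hx.mul_vt] at h2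
  exact d.trans (d.symm h1) h2

/-- Cancelling the prefix `x` leaves `y' ~ z * y₁'`. Cancelling the shorter of `y`, `y₁` then
reduces to `rel_mul_inv` or `rel_inv`. -/
theorem rel_of_le (H : BasicLE a d) (hΓ : Function.Injective Γ.s)
    (hx : Γ.IsPath p w n x x') (hy : Γ.IsPath q w m y y')
    (hx₁ : Γ.IsPath p w₁ n₁ x₁ x₁') (hy₁ : Γ.IsPath q w₁ m₁ y₁ y₁') (hn : n ≤ n₁)
    (h : a (x * y') (x₁ * y₁')) : d (x * y') (x₁ * y₁') := by
  obtain ⟨z, z', hz, rfl, rfl⟩ := hx.exists_of_le hΓ hx₁ hn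
  have h1 := a.mul_left_rel x' h
  simp only [mul_assoc, mul_mul_eq_of_mul_eq hx.inv_mul, hy.vt_mul',
    mul_mul_eq_of_mul_eq hz.vt_mul] at h1
  suffices hd : d y' (z * y₁') by
    have := d.mul_left_rel x hd
    rwa [← mul_assoc] at this
  rcases le_total m m₁ with hm | hm
  · obtain ⟨t, t', ht, rfl, rfl⟩ := hy.exists_of_le hΓ hy₁ hm
    have h2 := a.mul_right_rel y h1
    simp only [mul_assoc, hy.inv_mul, ht.mul_vt'] at h2
    have := d.mul_right_rel y' (H.rel_mul_inv hΓ hz ht (a.symm h2))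
    rw [hy.vt_mul', mul_assoc] at this
    exact d.symm this
  · obtain ⟨t, t', ht, rfl, rfl⟩ := hy₁.exists_of_le hΓ hy hm
    have h2 := a.mul_right_rel y₁ h1
    simp only [mul_assoc, hy₁.inv_mul, ht.mul_vt', hz.mul_vt] at h2
    exact d.mul_right_rel y₁' (H.rel_inv hz ht h2)

theorem rel_zero (H : BasicLE a d) {t : Γ.Inv} (h : a t 0) : d t 0 := by
  obtain rfl | ⟨p, q, w, n, m, x, x', y, y', hx, hy, rfl⟩ := Γ.isNormal t
  · exact d.refl _
  · rw [hx.rel_zero_iff hy] at h ⊢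
    exact H.zero _ h

theorem le (H : BasicLE a d) (hΓ : Function.Injective Γ.s) : a ≤ d := by
  intro s t h
  have hzero (h0 : a s 0) : d s t :=
    d.trans (H.rel_zero h0) (d.symm (H.rel_zero (a.trans (a.symm h) h0)))
  obtain rfl | ⟨p, q, w, n, m, x, x', y, y', hx, hy, rfl⟩ := Γ.isNormal s
  · exact hzero (a.refl _)
  obtain rfl | ⟨p₁, q₁, w₁, n₁, m₁, x₁, x₁', y₁, y₁', hx₁, hy₁, rfl⟩ := Γ.isNormal t
  · exact hzero h
  by_cases hp : p = p₁
  swap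
  · have := a.mul_left_rel (Γ.vt p) h
    rw [← mul_assoc, hx.vt_mul, ← mul_assoc, hx₁.vt_mul_of_ne hp, zero_mul] at this
    exact hzero this
  by_cases hq : q = q₁
  swap
  · have := a.mul_right_rel (Γ.vt q) h
    rw [mul_assoc, hy.mul_vt', mul_assoc, hy₁.mul_vt_of_ne' hq, mul_zero] at this
    exact hzero this
  subst hp hq
  rcases le_total n n₁ with hn | hn
  · exact H.rel_of_le hΓ hx hy hx₁ hy₁ hn h
  · exact d.symm (H.rel_of_le hΓ hx₁ hy₁ hx hy hn (a.symm h))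

end BasicLE

theorem source_injective_of_index_le_one (hΓ : ∀ w : V, Γ.index w ≤ 1) :
    Function.Injective Γ.s := by
  intro e f hef
  have : Subsingleton (Γ.s ⁻¹' {Γ.s f} : Set E) := Cardinal.le_one_iff_subsingleton.1 (hΓ _)
  exact congrArg Subtype.val (Subsingleton.elim (⟨e, hef⟩ : (Γ.s ⁻¹' {Γ.s f} : Set E)) ⟨f, rfl⟩)

end DirectedGraph

theorem mainTheorem4 {V : Type u} {E : Type v} (Γ : DirectedGraph V E)
    (hΓ : ∀ w : V, Γ.index w ≤ 1) :
    ∀ a b c : Γ.CongruenceLattice, (a ⊔ b) ⊓ c = (a ⊓ c) ⊔ (b ⊓ c) := by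
  intro a b c
  have hs := DirectedGraph.source_injective_of_index_le_one hΓ
  refine le_antisymm (DirectedGraph.BasicLE.le ⟨?_, ?_, ?_⟩ hs)
    (sup_le (inf_le_inf_right c le_sup_left) (inf_le_inf_right c le_sup_right))
  · intro p h
    obtain ⟨h, hc⟩ := Con.inf_iff_and.1 h
    exact DirectedGraph.rel_zero_sup_inf hs h hc
  · intro p w n x x' hx h
    obtain ⟨h, hc⟩ := Con.inf_iff_and.1 h
    exact hx.rel_idem_sup_inf hs h hc
  · intro p n x x' hx h
    obtain ⟨h, hc⟩ := Con.inf_iff_and.1 h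
    exact hx.rel_closed_sup_inf hs h hc
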